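/- Let $T$ be a finite tree with $n\ge 1$ vertices, and let $L(T)=D-A$ be its combinatorial Laplacian, where $D$ is the diagonal matrix of vertex degrees and $A$ is the adjacency matrix. Let $\lambda_1\ge\lambda_2\ge\dots\ge\lambda_n$ be the eigenvalues of $L(T)$, listed with multiplicity, and let $d^T_j=|\{v : \deg(v)\ge j\}|$ for $1\le j\le n$ be the conjugate degree sequence of $T$. Then the Grone–Merris conjecture holds for $T$, that is, $(\lambda_1,\dots,\lambda_n)$ is majorized by $(d^T_1,\dots,d^T_n)$: $$\sum_{i=1}^{k}\lambda_i\le\sum_{i=1}^{k}d^T_i\quad\text{for all } 1\le k\le n,\qquad\text{and}\qquad \sum_{i=1}^{n}\lambda_i=\sum_{i=1}^{n}d^T_i .$$ -/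

import Mathlib

/-- The conjugate of a finite family `p` of natural numbers (in particular of a partition):
its `j`-th term, `j ≥ 1`, is the number of indices `i` with `p i ≥ j`. It does not depend on the
order in which the terms of `p` are listed. -/
def conjugatePartition {ι : Type*} [Fintype ι] (p : ι → ℕ) (j : ℕ) : ℕ :=
  (Finset.univ.filter fun i => j ≤ p i).card

/-- Majorization `s ⊴ t` between non-increasing real sequences of the same length `n`. -/
structure IsMajorizedBy {n : ℕ} (s t : Fin n → ℝ) : Prop where
  antitone_left : Antitone s
  antitone_right : Antitone t
  sum_le : ∀ k : ℕ, k ≤ n →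
    ∑ i ∈ Finset.univ.filter (fun i : Fin n => i.val < k), s i ≤
      ∑ i ∈ Finset.univ.filter (fun i : Fin n => i.val < k), t i
  sum_eq : ∑ i, s i = ∑ i, t i

namespace SimpleGraph

/-- The eigenvalues of the combinatorial Laplacian `D - A`, with multiplicity, in
non-increasing order. -/
noncomputable def laplacianSpectrum {V : Type*} [Fintype V] [DecidableEq V]
    (G : SimpleGraph V) [DecidableRel G.Adj] : Fin (Fintype.card V) → ℝ :=
  (G.isHermitian_lapMatrix ℝ).eigenvalues₀

/-- The first `n = |V|` terms of the conjugate of the degree sequence; all later terms vanish,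
since degrees are at most `n - 1`. The entry at `j : Fin n` is the term of index `j + 1`. -/
def conjugateDegreeSequence {V : Type*} [Fintype V]
    (G : SimpleGraph V) [DecidableRel G.Adj] : Fin (Fintype.card V) → ℝ :=
  fun j => (conjugatePartition (fun v => G.degree v) (j.val + 1) : ℝ)

end SimpleGraph

open Finset

/-- A family of vectors indexed by `V` satisfying Bessel's inequality with constant one; these are
the rows of a matrix whose columns are orthonormal. -/
def IsBesselFamily {V E : Type*} [Fintype V] [NormedAddCommGroup E] [InnerProductSpace ℝ E]
    (y : V → E) : Prop :=
  ∀ w : V → ℝ, ‖∑ v, w v • y v‖ ^ 2 ≤ ∑ v, w v ^ 2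

theorem norm_sq_sum_le_card_mul {V E : Type*} [NormedAddCommGroup E] (y : V → E) (N : Finset V) :
    ‖∑ v ∈ N, y v‖ ^ 2 ≤ #N * ∑ v ∈ N, ‖y v‖ ^ 2 :=
  (pow_le_pow_left₀ (norm_nonneg _) (norm_sum_le N y) 2).trans sq_sum_le_card_mul_sum_sq

/-! ### Estimates for a single star -/

section Star

variable {V E : Type*} [NormedAddCommGroup E] [InnerProductSpace ℝ E]

theorem sum_norm_sub_sq (y : V → E) (u : V) (N : Finset V) :
    ∑ v ∈ N, ‖y u - y v‖ ^ 2 =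
      #N * ‖y u‖ ^ 2 - 2 * inner ℝ (y u) (∑ v ∈ N, y v) + ∑ v ∈ N, ‖y v‖ ^ 2 := by
  simp only [norm_sub_sq_real, sum_add_distrib, sum_sub_distrib, sum_const, nsmul_eq_mul,
    inner_sum, mul_sum]

variable [Fintype V] [DecidableEq V] {y : V → E}

theorem IsBesselFamily.star_le (hy : IsBesselFamily y) {u : V} {N : Finset V} (hu : u ∉ N) :
    (#N : ℝ) ^ 2 * ‖y u‖ ^ 2 - 2 * #N * inner ℝ (y u) (∑ v ∈ N, y v) + ‖∑ v ∈ N, y v‖ ^ 2 ≤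
      (#N : ℝ) ^ 2 + #N := by
  -- These weights, `#N` at the centre and `-1` at each leaf, form the top Laplacian eigenvector of
  -- the star.
  have h := hy fun v => (if v = u then (#N : ℝ) else 0) - (if v ∈ N then 1 else 0)
  have h1 : ∀ v, ((if v = u then (#N : ℝ) else 0) - (if v ∈ N then 1 else 0)) ^ 2 =
      (if v = u then (#N : ℝ) ^ 2 else 0) + (if v ∈ N then 1 else 0) := by
    intro v
    by_cases hv : v = u
    · subst hv; simp [hu]
    · by_cases hN : v ∈ N <;> simp [hv, hN]
  simp only [h1, sub_smul, ite_smul, zero_smul, one_smul, sum_sub_distrib, sum_add_distrib,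
    sum_ite_eq', mem_univ, if_true, sum_ite_mem, univ_inter, sum_const, nsmul_eq_mul,
    mul_one] at h
  rw [norm_sub_sq_real, norm_smul, mul_pow, real_inner_smul_left, Real.norm_natCast] at h
  linarith

theorem IsBesselFamily.norm_sub_sq_le_two (hy : IsBesselFamily y) {u v : V} (h : u ≠ v) :
    ‖y u - y v‖ ^ 2 ≤ 2 := by
  have := hy.star_le (u := u) (N := {v}) (by simpa using h)
  rw [norm_sub_sq_real]
  simp only [card_singleton, sum_singleton, Nat.cast_one] at this
  linarith

theorem IsBesselFamily.sum_star_le (hy : IsBesselFamily y) {u : V} {N : Finset V} (hu : u ∉ N) :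
    ∑ v ∈ N, ‖y u - y v‖ ^ 2 ≤ ‖y u‖ ^ 2 + ∑ v ∈ N, ‖y v‖ ^ 2 + #N := by
  have h1 := hy.star_le hu
  have h2 := sq_nonneg ‖y u + ∑ v ∈ N, y v‖
  rw [norm_add_sq_real] at h2
  rw [sum_norm_sub_sq]
  set d : ℝ := (#N : ℝ)
  have hd : 0 < d + 1 := by positivity
  refine le_of_mul_le_mul_left ?_ hd
  linear_combination h1 + h2

theorem IsBesselFamily.sum_star_le_two_mul (hy : IsBesselFamily y) {u : V} {N : Finset V}
    (hu : u ∉ N) (hN : N.Nonempty) :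
    ∑ v ∈ N, ‖y u - y v‖ ^ 2 ≤ 2 * (‖y u‖ ^ 2 + ∑ v ∈ N, ‖y v‖ ^ 2) + (#N - 1) := by
  have h1 := hy.star_le hu
  have h2 := sq_nonneg ‖y u + ∑ v ∈ N, y v‖
  have h3 := norm_sq_sum_le_card_mul y N
  rw [norm_add_sq_real] at h2
  rw [sum_norm_sub_sq]
  have hd1 : (1 : ℝ) ≤ #N := by exact_mod_cast hN.card_pos
  set d : ℝ := (#N : ℝ)
  have hd : 0 < d * (d + 1) := by positivity
  refine le_of_mul_le_mul_left ?_ hd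
  have h1' := mul_le_mul_of_nonneg_left h1 (sub_nonneg.2 hd1)
  have h2' := mul_nonneg (by positivity : 0 ≤ 2 * d) h2
  have h3' := mul_le_mul_of_nonneg_left h3 (by positivity : 0 ≤ d + 1)
  -- The multipliers `d - 1`, `2d`, `d + 1` cancel `‖∑ v ∈ N, y v‖ ^ 2` and match the inner product
  -- terms.
  linear_combination h1' + h2' + h3'

end Star

namespace SimpleGraph

variable {V : Type*} [Fintype V]

theorem sum_neighborFinset_swap (G : SimpleGraph V) [DecidableRel G.Adj] (f : V → V → ℝ) :
    ∑ u, ∑ v ∈ G.neighborFinset u, f u v = ∑ u, ∑ v ∈ G.neighborFinset u, f v u :=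
  Finset.sum_comm' (by simp [G.adj_comm])

/-- A graph without isolated vertices contains a minimal spanning subgraph without isolated
vertices; each of its edges has an end of degree one, so its components are stars. -/
theorem exists_spanning_star_forest (G : SimpleGraph V) (hG : ∀ v, ∃ w, G.Adj v w) :
    ∃ H ≤ G, (∀ v, ∃ w, H.Adj v w) ∧
      ∀ u v, H.Adj u v → (∀ w, H.Adj u w → w = v) ∨ (∀ w, H.Adj v w → w = u) := by
  classical
  obtain ⟨H, hHG, hH, hmin⟩ :=
    exists_minimal_le_of_wellFoundedLT (fun H : SimpleGraph V => ∀ v, ∃ w, H.Adj v w) G hG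
  refine ⟨H, hHG, hH, fun u v huv => ?_⟩
  by_contra! hcon
  obtain ⟨⟨a, hua, hav⟩, b, hvb, hbu⟩ := hcon
  have hdel : ∀ x, ∃ w, (H.deleteEdges {s(u, v)}).Adj x w := by
    intro x
    by_cases hxu : x = u
    · exact ⟨a, by subst hxu; simp [hua, hav, huv.ne]⟩
    · by_cases hxv : x = v
      · exact ⟨b, by subst hxv; simp [hvb, hbu, huv.ne']⟩
      · obtain ⟨w, hw⟩ := hH x
        exact ⟨w, by simp [hw, hxu, hxv]⟩
  have := hmin hdel (H.deleteEdges_le _) huv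
  simp at this

end SimpleGraph

/-! ### Edge sums over graphs and trees -/

section Graph

variable {V E : Type*} [Fintype V] [DecidableEq V] [NormedAddCommGroup E] [InnerProductSpace ℝ E]
  {y : V → E}

theorem IsBesselFamily.sum_star_forest_le (hy : IsBesselFamily y) (H : SimpleGraph V)
    [DecidableRel H.Adj] (hpos : ∀ v, ∃ w, H.Adj v w)
    (hstar : ∀ u v, H.Adj u v → (∀ w, H.Adj u w → w = v) ∨ (∀ w, H.Adj v w → w = u)) :
    ∑ u, ∑ v ∈ H.neighborFinset u, ‖y u - y v‖ ^ 2 ≤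
      4 * ∑ v, ‖y v‖ ^ 2 + 2 * ∑ v, ((H.degree v : ℝ) - 1) := by
  have hdeg : ∀ v, 1 ≤ H.degree v := fun v => by
    obtain ⟨w, hw⟩ := hpos v
    exact (H.degree_pos_iff_exists_adj v).2 ⟨w, hw⟩
  have hleaf : ∀ u v, H.Adj u v → (∀ w, H.Adj u w → w = v) → H.neighborFinset u = {v} := by
    intro u v huv h
    ext w
    simp only [SimpleGraph.mem_neighborFinset, mem_singleton]
    exact ⟨h w, fun hw => hw ▸ huv⟩
  have hends : ∀ u v, H.Adj u v → 2 ≤ H.degree u → H.neighborFinset v = {u} := by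
    intro u v huv h2
    rcases hstar u v huv with h | h
    · rw [← H.card_neighborFinset_eq_degree, hleaf u v huv h, card_singleton] at h2
      omega
    · exact hleaf v u huv.symm h
  have hdeg1 : ∀ u v, H.Adj u v → 2 ≤ H.degree u → ¬ 2 ≤ H.degree v := by
    intro u v huv h2
    rw [← H.card_neighborFinset_eq_degree, hends u v huv h2, card_singleton]
    omega
  -- the share of the edge `uv` that is charged to the star centred at `u`
  let θ : V → V → ℝ := fun u v =>
    if 2 ≤ H.degree u then 1 else if 2 ≤ H.degree v then 0 else 1 / 2
  have hθ : ∀ u v, H.Adj u v → θ u v + θ v u = 1 := by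
    intro u v huv
    have := hdeg1 u v huv
    by_cases h1 : 2 ≤ H.degree u
    · simp [θ, h1, this h1]
    · by_cases h2 : 2 ≤ H.degree v <;> simp [θ, h1, h2]
      norm_num
  have hθ0 : ∀ u v, 0 ≤ θ u v := fun u v => by simp only [θ]; split_ifs <;> norm_num
  -- The weight of `‖y u‖ ^ 2` when `u` acts as centre: 1 for a true centre, 0 for a leaf of a
  -- larger star, 1/2 at each end of an isolated edge.
  let A : V → ℝ := fun u => if 2 ≤ H.degree u then 1 else ∑ v ∈ H.neighborFinset u, θ u v
  have hone : ∀ u, ¬ 2 ≤ H.degree u → ∃ v, H.Adj u v ∧ H.neighborFinset u = {v} := by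
    intro u hu
    have : #(H.neighborFinset u) = 1 := by
      rw [H.card_neighborFinset_eq_degree]; have := hdeg u; omega
    obtain ⟨v, hv⟩ := card_eq_one.1 this
    exact ⟨v, by rw [← H.mem_neighborFinset, hv]; simp, hv⟩
  have hA : ∀ v, A v + ∑ u ∈ H.neighborFinset v, θ u v = 1 := by
    intro v
    by_cases h : 2 ≤ H.degree v
    · simp only [A, h, if_true, add_eq_left]
      refine sum_eq_zero fun u hu => ?_
      rw [H.mem_neighborFinset] at hu
      simp [θ, hdeg1 v u hu h, h]
    · obtain ⟨u, huv, hu⟩ := hone v h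
      simp only [A, h, if_false, hu, sum_singleton]
      exact hθ v u huv
  have hlocal : ∀ u, ∑ v ∈ H.neighborFinset u, θ u v * ‖y u - y v‖ ^ 2 ≤
      2 * (A u * ‖y u‖ ^ 2) + 2 * ∑ v ∈ H.neighborFinset u, θ u v * ‖y v‖ ^ 2 +
        ((H.degree u : ℝ) - 1) := by
    intro u
    have hb := hy.sum_star_le_two_mul (u := u) (N := H.neighborFinset u) (by simp)
      (card_pos.1 (by rw [H.card_neighborFinset_eq_degree]; exact hdeg u))
    rw [H.card_neighborFinset_eq_degree] at hb
    by_cases h : 2 ≤ H.degree u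
    · simp only [θ, A, h, if_true, one_mul]
      linarith
    · obtain ⟨v, huv, hv⟩ := hone u h
      have hd : (H.degree u : ℝ) = 1 := by
        rw [← H.card_neighborFinset_eq_degree, hv]; simp
      rw [hd] at hb ⊢
      simp only [A, h, if_false, hv, sum_singleton] at hb ⊢
      have := mul_le_mul_of_nonneg_left hb (hθ0 u v)
      linarith
  have hsplit : ∑ u, ∑ v ∈ H.neighborFinset u, ‖y u - y v‖ ^ 2 =
      2 * ∑ u, ∑ v ∈ H.neighborFinset u, θ u v * ‖y u - y v‖ ^ 2 := by
    have h1 := H.sum_neighborFinset_swap fun u v => θ u v * ‖y u - y v‖ ^ 2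
    rw [two_mul]
    nth_rewrite 2 [h1]
    simp only [← sum_add_distrib]
    refine sum_congr rfl fun u _ => sum_congr rfl fun v hv => ?_
    rw [norm_sub_rev (y v) (y u), ← add_mul, hθ u v ((H.mem_neighborFinset u v).1 hv), one_mul]
  have hsum := sum_le_sum fun u (_ : u ∈ univ) => hlocal u
  simp only [sum_add_distrib, ← mul_sum] at hsum
  rw [H.sum_neighborFinset_swap fun u v => θ u v * ‖y v‖ ^ 2] at hsum
  have hcoef : ∑ u, A u * ‖y u‖ ^ 2 + ∑ u, ∑ v ∈ H.neighborFinset u, θ v u * ‖y u‖ ^ 2 =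
      ∑ u, ‖y u‖ ^ 2 := by
    rw [← sum_add_distrib]
    refine sum_congr rfl fun u _ => ?_
    rw [← sum_mul, ← add_mul, hA, one_mul]
  rw [hsplit]
  linarith

/-- The sum of `|y u - y v| ^ 2` over ordered pairs of adjacent vertices of a graph without isolated
vertices. -/
theorem IsBesselFamily.sum_adj_le_of_no_isolated (hy : IsBesselFamily y) (G : SimpleGraph V)
    [DecidableRel G.Adj] (hG : ∀ v, ∃ w, G.Adj v w) :
    ∑ u, ∑ v ∈ G.neighborFinset u, ‖y u - y v‖ ^ 2 ≤
      4 * ∑ v, ‖y v‖ ^ 2 + 2 * ∑ v, ((G.degree v : ℝ) - 1) := by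
  classical
  obtain ⟨H, hHG, hpos, hstar⟩ := G.exists_spanning_star_forest hG
  have hH := hy.sum_star_forest_le H hpos hstar
  have hdiff : ∀ u, ∑ v ∈ G.neighborFinset u, ‖y u - y v‖ ^ 2 ≤
      ∑ v ∈ H.neighborFinset u, ‖y u - y v‖ ^ 2 + 2 * ((G.degree u : ℝ) - H.degree u) := by
    intro u
    have hsub : H.neighborFinset u ⊆ G.neighborFinset u := fun v hv => by
      simp only [SimpleGraph.mem_neighborFinset] at hv ⊢
      exact hHG hv
    rw [← sum_sdiff hsub, add_comm]
    have h2 : ∑ v ∈ G.neighborFinset u \ H.neighborFinset u, ‖y u - y v‖ ^ 2 ≤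
        ∑ v ∈ G.neighborFinset u \ H.neighborFinset u, 2 := by
      refine sum_le_sum fun v hv => hy.norm_sub_sq_le_two ?_
      simp only [mem_sdiff, SimpleGraph.mem_neighborFinset] at hv
      exact hv.1.ne
    rw [sum_const, nsmul_eq_mul, card_sdiff_of_subset hsub, Nat.cast_sub (card_le_card hsub)] at h2
    simp only [SimpleGraph.card_neighborFinset_eq_degree] at h2
    linarith
  have hsum := sum_le_sum fun u (_ : u ∈ univ) => hdiff u
  simp only [sum_add_distrib, ← mul_sum, sum_sub_distrib] at hsum hH ⊢
  linarith

theorem IsBesselFamily.sum_adj_le_degrees (hy : IsBesselFamily y) (G : SimpleGraph V)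
    [DecidableRel G.Adj] :
    ∑ u, ∑ v ∈ G.neighborFinset u, ‖y u - y v‖ ^ 2 ≤ 2 * ∑ v, (G.degree v : ℝ) := by
  rw [mul_sum]
  refine sum_le_sum fun u _ => ?_
  rw [← G.card_neighborFinset_eq_degree, mul_comm, ← nsmul_eq_mul]
  refine sum_le_card_nsmul _ _ _ fun v hv => hy.norm_sub_sq_le_two ?_
  exact ((G.mem_neighborFinset u v).1 hv).ne

/-- The star at `a` costs the total norm plus `deg a`, every other edge 2; ordered pairs double
this. -/
theorem IsBesselFamily.sum_adj_le_erase (hy : IsBesselFamily y) (G : SimpleGraph V)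
    [DecidableRel G.Adj] (a : V) :
    ∑ u, ∑ v ∈ G.neighborFinset u, ‖y u - y v‖ ^ 2 ≤
      2 * (∑ v, ‖y v‖ ^ 2 + ∑ v ∈ univ.erase a, (G.degree v : ℝ)) := by
  have hstar : ∑ v ∈ G.neighborFinset a, ‖y a - y v‖ ^ 2 ≤ ∑ v, ‖y v‖ ^ 2 + G.degree a := by
    have ha : a ∉ G.neighborFinset a := by simp
    have h := hy.sum_star_le ha
    rw [G.card_neighborFinset_eq_degree, ← sum_insert (f := fun v => ‖y v‖ ^ 2) ha] at h
    have := sum_le_sum_of_subset_of_nonneg (f := fun v => ‖y v‖ ^ 2)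
      (subset_univ (insert a (G.neighborFinset a))) fun v _ _ => sq_nonneg _
    linarith
  have hrest : ∀ u ∈ univ.erase a, ∑ v ∈ G.neighborFinset u, ‖y u - y v‖ ^ 2 ≤
      2 * (G.degree u : ℝ) + ∑ v ∈ G.neighborFinset u,
        if v = a then ‖y a - y u‖ ^ 2 - 2 else 0 := by
    intro u _
    have : 2 * (G.degree u : ℝ) = ∑ v ∈ G.neighborFinset u, 2 := by
      rw [sum_const, G.card_neighborFinset_eq_degree, nsmul_eq_mul, mul_comm]
    rw [this, ← sum_add_distrib]
    refine sum_le_sum fun v hv => ?_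
    split_ifs with h
    · rw [h, norm_sub_rev]; linarith
    · simpa using hy.norm_sub_sq_le_two ((G.mem_neighborFinset u v).1 hv).ne
  have hcorr : ∑ u ∈ univ.erase a, ∑ v ∈ G.neighborFinset u,
      (if v = a then ‖y a - y u‖ ^ 2 - 2 else 0) =
      ∑ u ∈ G.neighborFinset a, (‖y a - y u‖ ^ 2 - 2) := by
    have h1 : ∀ u, ∑ v ∈ G.neighborFinset u, (if v = a then ‖y a - y u‖ ^ 2 - 2 else 0) =
        if u ∈ G.neighborFinset a then ‖y a - y u‖ ^ 2 - 2 else 0 := by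
      intro u
      simp [sum_ite_eq', G.adj_comm]
    simp only [h1]
    rw [sum_ite_mem]
    congr 1
    ext v
    simp only [mem_inter, mem_erase, mem_univ, and_true, SimpleGraph.mem_neighborFinset]
    exact ⟨fun h => h.2, fun h => ⟨h.ne', h⟩⟩
  have hsum := sum_le_sum hrest
  rw [sum_add_distrib, hcorr, sum_sub_distrib, sum_const, G.card_neighborFinset_eq_degree,
    nsmul_eq_mul, ← mul_sum] at hsum
  rw [← add_sum_erase _ _ (mem_univ a)]
  linarith

/-- Grone--Merris type bound for trees: the degree side is the sum of the first `k` terms of the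
conjugate degree sequence. -/
theorem IsBesselFamily.sum_adj_le_sum_min_degree (hy : IsBesselFamily y) (T : SimpleGraph V)
    [DecidableRel T.Adj] (hT : T.IsTree) {k : ℕ} (hk : ∑ v, ‖y v‖ ^ 2 = k) :
    ∑ u, ∑ v ∈ T.neighborFinset u, ‖y u - y v‖ ^ 2 ≤
      2 * ∑ v, (min (T.degree v) k : ℕ) := by
  by_cases h0 : ∀ v, T.degree v ≤ k
  · refine (hy.sum_adj_le_degrees T).trans_eq ?_
    push_cast
    congr 1
    exact sum_congr rfl fun v _ => by rw [min_eq_left]; exact_mod_cast h0 v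
  push Not at h0
  obtain ⟨a, ha⟩ := h0
  by_cases h1 : ∀ v, v ≠ a → T.degree v ≤ k
  · refine (hy.sum_adj_le_erase T a).trans_eq ?_
    push_cast
    rw [hk, ← add_sum_erase _ _ (mem_univ a)]
    congr 2
    · rw [min_eq_right]; exact_mod_cast ha.le
    · refine sum_congr rfl fun v hv => ?_
      rw [min_eq_left]; exact_mod_cast h1 v (ne_of_mem_erase hv)
  push Not at h1
  obtain ⟨b, hba, hb⟩ := h1
  have hnt : Nontrivial V := ⟨⟨b, a, hba⟩⟩
  have hpos : ∀ v, 1 ≤ T.degree v := fun v => hT.connected.preconnected.degree_pos_of_nontrivial v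
  -- The lower bound `min (deg v) k ≥ 1` used below needs `k ≥ 1`.
  rcases Nat.eq_zero_or_pos k with rfl | hk1
  · have hz : ∀ v, y v = 0 := by
      intro v
      rw [Nat.cast_zero, sum_eq_zero_iff_of_nonneg fun v _ => sq_nonneg _] at hk
      simpa using hk v (mem_univ v)
    simp [hz]
  have hmain := hy.sum_adj_le_of_no_isolated T fun v =>
    (T.degree_pos_iff_exists_adj v).1 (hpos v)
  have hdeg : ∑ v, (T.degree v : ℝ) = 2 * (Fintype.card V - 1) := by
    have h := T.sum_degrees_eq_twice_card_edges
    have h' : (#T.edgeFinset : ℝ) + 1 = Fintype.card V := by exact_mod_cast hT.card_edgeFinset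
    rw [← h', ← Nat.cast_sum, h]
    push_cast; ring
  have hmin : (2 * k + (Fintype.card V - 2) : ℝ) ≤ ∑ v, (min (T.degree v) k : ℕ) := by
    have hb' : b ∈ univ.erase a := mem_erase.2 ⟨hba, mem_univ b⟩
    rw [← add_sum_erase _ _ (mem_univ a), ← add_sum_erase _ _ hb', min_eq_right ha.le,
      min_eq_right hb.le]
    have hcard : #((univ.erase a).erase b) + 2 = Fintype.card V := by
      have h1 := card_erase_add_one hb'
      have h2 := card_erase_add_one (mem_univ a)
      rw [card_univ] at h2
      omega
    have : #((univ.erase a).erase b) ≤ ∑ v ∈ (univ.erase a).erase b, min (T.degree v) k := by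
      rw [card_eq_sum_ones]
      exact sum_le_sum fun v _ => le_min (hpos v) hk1
    have h' : (#((univ.erase a).erase b) : ℝ) + 2 = Fintype.card V := by exact_mod_cast hcard
    push_cast
    have h'' : (#((univ.erase a).erase b) : ℝ) ≤
        ∑ v ∈ (univ.erase a).erase b, min (T.degree v : ℝ) k := by exact_mod_cast this
    linarith
  rw [hk, sum_sub_distrib, hdeg] at hmain
  simp only [sum_const, card_univ, nsmul_eq_mul, mul_one] at hmain
  push_cast at hmin ⊢
  linarith

end Graph

/-! ### Conjugate sums and spectral data -/

theorem sum_conjugatePartition {ι : Type*} [Fintype ι] (p : ι → ℕ) {n k : ℕ} (hk : k ≤ n) :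
    ∑ j : Fin n with j.val < k, conjugatePartition p (j.val + 1) = ∑ i, min (p i) k := by
  simp only [conjugatePartition, card_filter]
  rw [sum_comm]
  refine sum_congr rfl fun i _ => ?_
  rw [← card_filter, filter_filter]
  have : #{j : Fin n | j.val < k ∧ j.val + 1 ≤ p i} = #(range (min (p i) k)) := by
    rw [← card_map Fin.valEmbedding]
    congr 1
    ext m
    simp only [mem_map, mem_filter, mem_univ, true_and, Fin.valEmbedding_apply, mem_range, lt_min_iff]
    constructor
    · rintro ⟨j, h, rfl⟩; omega
    · intro h; exact ⟨⟨m, by omega⟩, ⟨h.2, h.1⟩, rfl⟩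
  rw [this, card_range]

/-- The coordinates of `∑ v, w v • y v` are the inner products of `w` with the `b i`, so this is
Bessel's inequality for `w`. -/
theorem Orthonormal.isBesselFamily {ι V : Type*} [Fintype ι] [Fintype V]
    {b : ι → EuclideanSpace ℝ V} (hb : Orthonormal ℝ b) :
    IsBesselFamily fun v => WithLp.toLp 2 fun i => b i v := by
  intro w
  have h := hb.sum_inner_products_le (WithLp.toLp 2 w) (s := univ)
  rw [EuclideanSpace.real_norm_sq_eq] at h ⊢
  refine le_trans (le_of_eq ?_) h
  refine sum_congr rfl fun i _ => ?_
  simp [PiLp.inner_apply]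

theorem Orthonormal.sum_norm_sq_rows {ι V : Type*} [Fintype ι] [Fintype V]
    {b : ι → EuclideanSpace ℝ V} (hb : Orthonormal ℝ b) :
    ∑ v, ‖(WithLp.toLp 2 fun i => b i v : EuclideanSpace ℝ ι)‖ ^ 2 = Fintype.card ι := by
  simp only [EuclideanSpace.real_norm_sq_eq]
  rw [sum_comm]
  simp [← EuclideanSpace.real_norm_sq_eq, hb.1]

namespace SimpleGraph

section ConjugateDegrees

variable {V : Type*} [Fintype V] (G : SimpleGraph V) [DecidableRel G.Adj]

theorem sum_conjugateDegreeSequence {k : ℕ} (hk : k ≤ Fintype.card V) :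
    ∑ j : Fin (Fintype.card V) with j.val < k, G.conjugateDegreeSequence j =
      ∑ v, (min (G.degree v) k : ℕ) := by
  rw [← sum_conjugatePartition _ hk]
  simp [conjugateDegreeSequence]

theorem conjugateDegreeSequence_antitone : Antitone G.conjugateDegreeSequence := by
  intro i j hij
  refine Nat.cast_le.2 (card_le_card fun v => ?_)
  simp only [mem_filter, mem_univ, true_and]
  have : i.val ≤ j.val := hij
  omega

end ConjugateDegrees

variable {V : Type*} [Fintype V] [DecidableEq V] (G : SimpleGraph V) [DecidableRel G.Adj]

/-- The eigenvectors belonging to the eigenvalues in non-increasing order. -/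
theorem exists_orthonormal_laplacianSpectrum : ∃ b : Fin (Fintype.card V) → EuclideanSpace ℝ V,
    Orthonormal ℝ b ∧ ∀ j, 2 * G.laplacianSpectrum j =
      ∑ u, ∑ v ∈ G.neighborFinset u, (b j u - b j v) ^ 2 := by
  let e : Fin (Fintype.card V) ≃ V := Fintype.equivOfCardEq (Fintype.card_fin _)
  have hL := G.isHermitian_lapMatrix ℝ
  refine ⟨fun j => hL.eigenvectorBasis (e j),
    hL.eigenvectorBasis.orthonormal.comp e e.injective, fun j => ?_⟩
  have h1 : G.laplacianSpectrum j = hL.eigenvalues (e j) := by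
    simp [laplacianSpectrum, Matrix.IsHermitian.eigenvalues, e]
  have h2 := G.lapMatrix_toLinearMap₂' ℝ (hL.eigenvectorBasis (e j))
  rw [Matrix.toLinearMap₂'_apply'] at h2
  rw [h1, hL.eigenvalues_eq]
  simp only [star_trivial, RCLike.re_to_real, h2]
  rw [mul_div_cancel₀ _ two_ne_zero]
  refine sum_congr rfl fun u _ => ?_
  rw [← sum_filter, ← neighborFinset_eq_filter]

theorem sum_laplacianSpectrum : ∑ j, G.laplacianSpectrum j = ∑ v, (G.degree v : ℝ) := by
  have h := (G.isHermitian_lapMatrix ℝ).trace_eq_sum_eigenvalues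
  simp only [Matrix.IsHermitian.eigenvalues, RCLike.ofReal_real_eq_id, id] at h
  rw [Equiv.sum_comp] at h
  rw [laplacianSpectrum, ← h]
  simp [Matrix.trace, lapMatrix, degMatrix]

end SimpleGraph

theorem mainTheorem2 {V : Type*} [Fintype V] [DecidableEq V]
    (T : SimpleGraph V) [DecidableRel T.Adj] (hT : T.IsTree) :
    IsMajorizedBy T.laplacianSpectrum T.conjugateDegreeSequence := by
  refine ⟨(T.isHermitian_lapMatrix ℝ).eigenvalues₀_antitone, T.conjugateDegreeSequence_antitone,
    fun k hk => ?_, ?_⟩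
  · rw [T.sum_conjugateDegreeSequence hk]
    obtain ⟨b, hb, hlam⟩ := T.exists_orthonormal_laplacianSpectrum
    have hb' : Orthonormal ℝ fun j : {j : Fin (Fintype.card V) // j.val < k} => b j :=
      hb.comp _ Subtype.val_injective
    have hcard : Fintype.card {j : Fin (Fintype.card V) // j.val < k} = k := by
      rw [Fintype.card_subtype, Fin.card_filter_val_lt, min_eq_right hk]
    have h := hb'.isBesselFamily.sum_adj_le_sum_min_degree T hT (k := k)
      (by rw [hb'.sum_norm_sq_rows, hcard])
    have hsum : 2 * ∑ j : Fin (Fintype.card V) with j.val < k, T.laplacianSpectrum j =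
        ∑ u, ∑ v ∈ T.neighborFinset u,
          ∑ j : {j : Fin (Fintype.card V) // j.val < k}, (b j u - b j v) ^ 2 := by
      simp only [mul_sum, hlam]
      rw [← sum_subtype_eq_sum_filter, subtype_univ, sum_comm]
      refine sum_congr rfl fun u _ => ?_
      rw [sum_comm]
    simp only [EuclideanSpace.real_norm_sq_eq, PiLp.sub_apply] at h
    rw [← hsum] at h
    push_cast at h ⊢
    linarith
  · have h := T.sum_conjugateDegreeSequence le_rfl
    simp only [Fin.is_lt, filter_true] at h
    rw [T.sum_laplacianSpectrum, h]
    push_cast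
    refine sum_congr rfl fun v _ => ?_
    rw [min_eq_left]
    exact_mod_cast (T.degree_lt_card_verts v).le
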